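/- Theorem 8. Let $d,n\ge 1$ be integers and let $\nu$ be a finite non-negative Borel measure on $[0,\infty)$ with $\operatorname{supp}(\nu)\neq\{0\}$. Let $k(x,y)=\int_0^\infty e^{-t\|x-y\|_2^2}\,d\nu(t)$ for $x,y\in\mathbb{R}^d$, let $\mathcal{H}_k$ be the reproducing kernel Hilbert space of $k$, and for a Borel probability measure $P$ on $\mathbb{R}^d$ let $\mu_k(P)=\int k(\cdot,x)\,dP(x)\in\mathcal{H}_k$ (Bochner integral) be its kernel mean embedding. Let $\mathcal{P}$ be the set of Borel probability measures on $\mathbb{R}^d$ that have an infinitely differentiable density with respect to Lebesgue measure. Assume that there exist $0<t_0\le t_1<\infty$ and $0<\beta<\infty$ such that $\nu([t_0,t_1])\ge\beta$. Then $$\inf_{\hat\theta_n}\ \sup_{P\in\mathcal{P}}\ P^n\left\{\|\hat\theta_n-\mu_k(P)\|_{\mathcal{H}_k}\ \ge\ \frac{1}{50}\sqrt{\frac1n\cdot\frac{\beta t_0}{t_1 e}\left(1-\frac{2}{2+d}\right)}\right\}\ \ge\ \frac15,$$ where $P^n$ is the law of an i.i.d. sample $X_1,\dots,X_n$ from $P$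 and the infimum is over all estimators $\hat\theta_n$, that is, all measurable maps $\hat\theta_n:(\mathbb{R}^d)^n\to\mathcal{H}_k$ of the sample. -/

import Mathlib

open MeasureTheory ProbabilityTheory Real
open scoped NNReal ENNReal ContDiff InnerProductSpace

/-- The radial kernel `k(x, y) = ∫_{[0,∞)} exp (-t ‖x - y‖²) dν(t)` on `ℝ^d` (Euclidean norm). -/
noncomputable def radialKernel {d : ℕ} (ν : Measure ℝ≥0) (x y : EuclideanSpace ℝ (Fin d)) : ℝ :=
  ∫ t : ℝ≥0, Real.exp (-(t : ℝ) * ‖x - y‖ ^ 2) ∂ν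

/-- The radial kernel in the operator-valued form that Mathlib's reproducing kernel Hilbert spaces
use: the `(x, y)` entry is multiplication by `k(x, y)` on `ℝ`. -/
noncomputable def radialKernelMatrix (d : ℕ) (ν : Measure ℝ≥0) :
    Matrix (EuclideanSpace ℝ (Fin d)) (EuclideanSpace ℝ (Fin d)) (ℝ →L[ℝ] ℝ) :=
  Matrix.of fun x y => radialKernel ν x y • (1 : ℝ →L[ℝ] ℝ)

theorem integrable_radialKernel_integrand {d : ℕ} (ν : Measure ℝ≥0) [IsFiniteMeasure ν]
    (x y : EuclideanSpace ℝ (Fin d)) :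
    Integrable (fun t : ℝ≥0 => Real.exp (-(t : ℝ) * ‖x - y‖ ^ 2)) ν := by
  refine Integrable.of_bound (C := 1) (by fun_prop) (ae_of_all _ fun t => ?_)
  rw [Real.norm_eq_abs, Real.abs_exp, Real.exp_le_one_iff]
  have : 0 ≤ (t : ℝ) * ‖x - y‖ ^ 2 := by positivity
  linarith

theorem radialKernel_symm {d : ℕ} (ν : Measure ℝ≥0) (x y : EuclideanSpace ℝ (Fin d)) :
    radialKernel ν x y = radialKernel ν y x := by
  simp only [radialKernel, norm_sub_rev x y]

theorem exp_neg_mul_sq_eq_integral_cos {d : ℕ} (t : ℝ≥0) (x y : EuclideanSpace ℝ (Fin d)) :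
    Real.exp (-(t : ℝ) * ‖x - y‖ ^ 2) =
      ∫ z, Real.cos (√(2 * t) * ⟪z, x⟫_ℝ - √(2 * t) * ⟪z, y⟫_ℝ)
        ∂(stdGaussian (EuclideanSpace ℝ (Fin d))) := by
  have h := charFun_stdGaussian (E := EuclideanSpace ℝ (Fin d)) (√(2 * (t : ℝ)) • (x - y))
  have h2 : (-((‖√(2 * (t : ℝ)) • (x - y)‖ ^ 2 : ℝ)) / 2) = -(t : ℝ) * ‖x - y‖ ^ 2 := by
    rw [norm_smul, mul_pow, Real.norm_eq_abs, sq_abs, Real.sq_sqrt (by positivity)]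
    ring
  have h3 := congrArg Complex.re h
  rw [charFun_apply] at h3
  have hint : Integrable (fun z : EuclideanSpace ℝ (Fin d) =>
      Complex.exp (⟪z, √(2 * (t : ℝ)) • (x - y)⟫_ℝ * Complex.I))
      (stdGaussian (EuclideanSpace ℝ (Fin d))) := by
    refine Integrable.of_bound (C := 1) (by fun_prop) (ae_of_all _ fun z => ?_)
    rw [Complex.norm_exp_ofReal_mul_I]
  have h4 := integral_re hint
  simp only [RCLike.re_eq_complex_re] at h4
  rw [← h4] at h3
  simp only [Complex.exp_ofReal_mul_I_re] at h3
  rw [← h2, ← Complex.exp_ofReal_re]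
  push_cast
  rw [← h3]
  simp only [inner_smul_right, inner_sub_right, mul_sub]

/-- The radial kernel of a finite measure is positive definite. -/
theorem radialKernelMatrix_posSemidef (d : ℕ) (ν : Measure ℝ≥0) [IsFiniteMeasure ν] :
    (radialKernelMatrix d ν).PosSemidef := by
  have htfae := (RKHS.posSemidef_tfae (K := radialKernelMatrix d ν)).out 0 2 rfl rfl
  refine htfae.mpr ⟨?_, fun v => ?_⟩
  · ext x y
    simp [radialKernelMatrix, radialKernel_symm ν x y]
  · have key : ∀ t : ℝ≥0, 0 ≤ ∑ x ∈ v.support, ∑ y ∈ v.support,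
        (v x * v y) * Real.exp (-(t : ℝ) * ‖y - x‖ ^ 2) := by
      intro t
      have hi : ∀ x y : EuclideanSpace ℝ (Fin d), Integrable (fun z =>
          Real.cos (√(2 * t) * ⟪z, y⟫_ℝ - √(2 * t) * ⟪z, x⟫_ℝ))
          (stdGaussian (EuclideanSpace ℝ (Fin d))) := fun x y =>
        Integrable.of_bound (C := 1) (by fun_prop) (ae_of_all _ fun z => Real.abs_cos_le_one _)
      simp_rw [exp_neg_mul_sq_eq_integral_cos, ← integral_const_mul]
      have h1 : ∀ x ∈ v.support, Integrable (fun z => ∑ y ∈ v.support, v x * v y *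
          Real.cos (√(2 * t) * ⟪z, y⟫_ℝ - √(2 * t) * ⟪z, x⟫_ℝ))
          (stdGaussian (EuclideanSpace ℝ (Fin d))) := fun x _ =>
        integrable_finsetSum _ fun y _ => (hi x y).const_mul _
      have h2 : ∀ x ∈ v.support, ∑ y ∈ v.support, ∫ z, v x * v y *
          Real.cos (√(2 * t) * ⟪z, y⟫_ℝ - √(2 * t) * ⟪z, x⟫_ℝ)
          ∂(stdGaussian (EuclideanSpace ℝ (Fin d))) = ∫ z, ∑ y ∈ v.support, v x * v y *
          Real.cos (√(2 * t) * ⟪z, y⟫_ℝ - √(2 * t) * ⟪z, x⟫_ℝ)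
          ∂(stdGaussian (EuclideanSpace ℝ (Fin d))) := fun x _ =>
        (integral_finsetSum _ fun y _ => (hi x y).const_mul _).symm
      rw [Finset.sum_congr rfl h2, ← integral_finsetSum _ h1]
      refine integral_nonneg fun z => ?_
      have h3 : ∑ x ∈ v.support, ∑ y ∈ v.support, v x * v y *
          Real.cos (√(2 * t) * ⟪z, y⟫_ℝ - √(2 * t) * ⟪z, x⟫_ℝ) =
          (∑ x ∈ v.support, v x * Real.cos (√(2 * t) * ⟪z, x⟫_ℝ)) ^ 2 +
          (∑ x ∈ v.support, v x * Real.sin (√(2 * t) * ⟪z, x⟫_ℝ)) ^ 2 := by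
        rw [sq, sq, Finset.sum_mul_sum, Finset.sum_mul_sum, ← Finset.sum_add_distrib]
        refine Finset.sum_congr rfl fun x _ => ?_
        rw [← Finset.sum_add_distrib]
        refine Finset.sum_congr rfl fun y _ => ?_
        rw [Real.cos_sub]
        ring
      simp only [Pi.zero_apply]
      rw [h3]
      positivity
    have h : (v.sum fun x w => v.sum fun y w' => ⟪radialKernelMatrix d ν y x w, w'⟫_ℝ) =
        ∫ t : ℝ≥0, ∑ x ∈ v.support, ∑ y ∈ v.support,
        (v x * v y) * Real.exp (-(t : ℝ) * ‖y - x‖ ^ 2) ∂ν := by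
      rw [integral_finsetSum _ fun x _ => integrable_finsetSum _ fun y _ =>
        (integrable_radialKernel_integrand ν y x).const_mul _]
      refine Finset.sum_congr rfl fun x _ => ?_
      rw [integral_finsetSum _ fun y _ => (integrable_radialKernel_integrand ν y x).const_mul _]
      refine Finset.sum_congr rfl fun y _ => ?_
      rw [integral_const_mul]
      simp [radialKernelMatrix, radialKernel]
      ring
    rw [h]
    exact integral_nonneg key

instance radialKernelMatrix_fact (d : ℕ) (ν : Measure ℝ≥0) [IsFiniteMeasure ν] :
    Fact (radialKernelMatrix d ν).PosSemidef :=
  ⟨radialKernelMatrix_posSemidef d ν⟩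

/-- The reproducing kernel Hilbert space of the radial kernel on `ℝ^d`. -/
noncomputable abbrev RadialRKHS (d : ℕ) (ν : Measure ℝ≥0) [IsFiniteMeasure ν] : Type :=
  RKHS.OfKernel (radialKernelMatrix d ν)

/-- The RKHS carries its Borel sigma-algebra. -/
noncomputable instance radialRKHS_measurableSpace (d : ℕ) (ν : Measure ℝ≥0) [IsFiniteMeasure ν] :
    MeasurableSpace (RadialRKHS d ν) :=
  borel _

instance radialRKHS_borelSpace (d : ℕ) (ν : Measure ℝ≥0) [IsFiniteMeasure ν] :
    BorelSpace (RadialRKHS d ν) :=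
  ⟨rfl⟩

/-- The canonical feature map `x ↦ k(·, x)` into the RKHS. -/
noncomputable def radialFeature {d : ℕ} (ν : Measure ℝ≥0) [IsFiniteMeasure ν]
    (x : EuclideanSpace ℝ (Fin d)) : RadialRKHS d ν :=
  RKHS.kerFun (RadialRKHS d ν) x 1

/-- As a function on `ℝ^d`, the feature of `x` is `k(·, x)`. -/
theorem radialFeature_apply {d : ℕ} (ν : Measure ℝ≥0) [IsFiniteMeasure ν]
    (x y : EuclideanSpace ℝ (Fin d)) : radialFeature ν x y = radialKernel ν y x := by
  rw [radialFeature, RKHS.kerFun_apply, RKHS.OfKernel.kernel_ofKernel]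
  simp [radialKernelMatrix]

/-- The reproducing property. -/
theorem inner_radialFeature {d : ℕ} (ν : Measure ℝ≥0) [IsFiniteMeasure ν]
    (f : RadialRKHS d ν) (x : EuclideanSpace ℝ (Fin d)) : ⟪f, radialFeature ν x⟫_ℝ = f x := by
  rw [radialFeature, RKHS.inner_kerFun]
  simp

theorem continuous_radialFeature {d : ℕ} (ν : Measure ℝ≥0) [IsFiniteMeasure ν] :
    Continuous (radialFeature (d := d) ν) := by
  have hk : Continuous fun p : EuclideanSpace ℝ (Fin d) × EuclideanSpace ℝ (Fin d) =>
      radialKernel ν p.1 p.2 := by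
    refine continuous_of_dominated (bound := fun _ => 1)
      (fun p => (integrable_radialKernel_integrand ν p.1 p.2).aestronglyMeasurable)
      (fun p => ae_of_all _ fun t => ?_) (integrable_const _) (ae_of_all _ fun t => by fun_prop)
    rw [Real.norm_eq_abs, Real.abs_exp, Real.exp_le_one_iff]
    have : 0 ≤ (t : ℝ) * ‖p.1 - p.2‖ ^ 2 := by positivity
    linarith
  have hd : ∀ x y : EuclideanSpace ℝ (Fin d), ‖radialFeature ν x - radialFeature ν y‖ =
      √(radialKernel ν x x - 2 * radialKernel ν x y + radialKernel ν y y) := by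
    intro x y
    rw [← Real.sqrt_sq (norm_nonneg (radialFeature ν x - radialFeature ν y)),
      norm_sub_sq_real, ← real_inner_self_eq_norm_sq, ← real_inner_self_eq_norm_sq]
    simp only [inner_radialFeature, radialFeature_apply]
    rw [radialKernel_symm ν y x]
  rw [continuous_iff_continuousAt]
  intro x
  rw [ContinuousAt, tendsto_iff_norm_sub_tendsto_zero]
  simp only [hd]
  have hc : Continuous fun y : EuclideanSpace ℝ (Fin d) =>
      √(radialKernel ν y y - 2 * radialKernel ν y x + radialKernel ν x x) := by
    have h1 := hk.comp (continuous_id.prodMk continuous_id)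
    have h2 := hk.comp (continuous_id.prodMk (continuous_const (y := x)))
    exact ((h1.sub (h2.const_mul 2)).add continuous_const).sqrt
  have h0 := hc.tendsto x
  rwa [show radialKernel ν x x - 2 * radialKernel ν x x + radialKernel ν x x = 0 by ring,
    Real.sqrt_zero] at h0

/-- The feature map is Bochner integrable, so kernel mean embeddings are never junk values. -/
theorem integrable_radialFeature {d : ℕ} (ν : Measure ℝ≥0) [IsFiniteMeasure ν]
    (P : Measure (EuclideanSpace ℝ (Fin d))) [IsFiniteMeasure P] :
    Integrable (radialFeature ν) P := by
  refine Integrable.of_bound (C := √(ν.real Set.univ))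
    (continuous_radialFeature ν).aestronglyMeasurable (ae_of_all _ fun x => ?_)
  rw [← Real.sqrt_sq (norm_nonneg (radialFeature ν x)), ← real_inner_self_eq_norm_sq,
    inner_radialFeature, radialFeature_apply]
  simp [radialKernel]

/-- The kernel mean embedding `μ_k(P) = ∫ k(·, x) dP(x)`, a Bochner integral in the RKHS. -/
noncomputable def kernelMean {d : ℕ} (ν : Measure ℝ≥0) [IsFiniteMeasure ν]
    (P : Measure (EuclideanSpace ℝ (Fin d))) : RadialRKHS d ν :=
  ∫ x, radialFeature ν x ∂P

/-- The Borel probability measures on `ℝ^d` that have an infinitely differentiable density with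
respect to Lebesgue measure. -/
def smoothDensityMeasures (d : ℕ) : Set (Measure (EuclideanSpace ℝ (Fin d))) :=
  {P | IsProbabilityMeasure P ∧ ∃ p : EuclideanSpace ℝ (Fin d) → ℝ,
    ContDiff ℝ ∞ p ∧ (∀ x, 0 ≤ p x) ∧ P = volume.withDensity fun x => ENNReal.ofReal (p x)}

/-- The estimators of an element of the RKHS from a sample of size `n`: the measurable maps from
samples to the RKHS. -/
abbrev Estimator (n d : ℕ) (ν : Measure ℝ≥0) [IsFiniteMeasure ν] : Type :=
  {θ : (Fin n → EuclideanSpace ℝ (Fin d)) → RadialRKHS d ν // Measurable θ}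

/-! This is Le Cam's two-point method. Take smooth bumps `Q₀`, `Q₁` with disjoint supports,
concentrated near points at distance `1/√t₀`, so that their kernel means are at least `√β/2` apart
(`exists_bumpMeasure_separated`). Compare the balanced mixture with the one of weights `(1 ± a)/2`,
where `a² = 1/(2n)`. By linearity their kernel means differ by `a/2` times that gap, which is of
order `√(β/n)` and at least twice the target radius.

Statistically the two mixtures are close. Their likelihood ratio takes only the values `1 ± a`, so
for `n` samples its second moment is `(1 + 1/(2n))^n ≤ 9/5`, and `pi_withDensity_apply_le` transfers
the probability of an event from one law to the other. An estimator that errs with probability below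
`1/5` under both mixtures would then make a total mass of 1 at most `4/5`. -/

/-! ### Change of measure for i.i.d. samples -/

theorem lintegral_prod_pi_eq_prod {ι α : Type*} [Fintype ι] [MeasurableSpace α]
    (P : ι → Measure α) [∀ i, IsProbabilityMeasure (P i)] (f : ι → α → ℝ≥0∞)
    (hf : ∀ i, Measurable (f i)) :
    ∫⁻ x, ∏ i, f i (x i) ∂(Measure.pi P) = ∏ i, ∫⁻ x, f i x ∂(P i) := by
  have hind : iIndepFun (fun i (x : ι → α) => f i (x i)) (Measure.pi P) :=
    iIndepFun_pi fun i => (hf i).aemeasurable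
  rw [lintegral_prod_eq_prod_lintegral_of_indepFun Finset.univ _ hind
    fun i => (hf i).comp (measurable_pi_apply i)]
  refine Finset.prod_congr rfl fun i _ => ?_
  exact (measurePreserving_eval P i).lintegral_comp (hf i)

theorem pi_withDensity_eq {ι α : Type*} [Fintype ι] [MeasurableSpace α]
    (P : Measure α) [IsProbabilityMeasure P] (L : α → ℝ≥0∞) (hL : Measurable L)
    [IsProbabilityMeasure (P.withDensity L)] :
    Measure.pi (fun _ : ι => P.withDensity L) =
      (Measure.pi fun _ : ι => P).withDensity fun x => ∏ i, L (x i) := by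
  refine Measure.pi_eq fun s hs => ?_
  rw [withDensity_apply _ (MeasurableSet.univ_pi hs),
    ← lintegral_indicator (MeasurableSet.univ_pi hs)]
  have h : ∀ x : ι → α, (Set.univ.pi s).indicator (fun x => ∏ i, L (x i)) x =
      ∏ i, (s i).indicator L (x i) := by
    intro x
    by_cases hx : x ∈ Set.univ.pi s
    · rw [Set.indicator_of_mem hx]
      exact Finset.prod_congr rfl fun i _ => (Set.indicator_of_mem (hx i trivial) L).symm
    · rw [Set.indicator_of_notMem hx]
      obtain ⟨i, hi⟩ : ∃ i, x i ∉ s i := by simpa [Set.mem_univ_pi] using hx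
      exact (Finset.prod_eq_zero (Finset.mem_univ i) (Set.indicator_of_notMem hi L)).symm
  simp_rw [h]
  rw [lintegral_prod_pi_eq_prod (fun _ => P) _ fun i => hL.indicator (hs i)]
  refine Finset.prod_congr rfl fun i _ => ?_
  rw [lintegral_indicator (hs i), withDensity_apply _ (hs i)]

/-- Expanding `(y - 3)² ≥ 0`. Among the bounds `y ≤ c/2 + y²/(2c)`, the choice `c = 3` minimises
`c/2 · 1/5 + (9/5)/(2c)`, the quantity that enters the final contradiction. -/
theorem ENNReal.le_three_halves_add_sq_div_six (y : ℝ≥0∞) : y ≤ 3 / 2 + y ^ 2 / 6 := by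
  induction y with
  | top => simp [ENNReal.top_div]
  | coe y =>
    have h : y ≤ 3 / 2 + y ^ 2 / 6 := by
      rw [← NNReal.coe_le_coe]
      push_cast
      nlinarith [sq_nonneg ((y : ℝ) - 3)]
    have h2 : ((3 / 2 + y ^ 2 / 6 : ℝ≥0) : ℝ≥0∞) = 3 / 2 + (y : ℝ≥0∞) ^ 2 / 6 := by
      rw [ENNReal.coe_add, ENNReal.coe_div (by norm_num), ENNReal.coe_div (by norm_num)]
      norm_num
    rw [← h2]
    exact_mod_cast h

/-- Change of measure for product measures, with the error controlled by the second moment of the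
likelihood ratio. -/
theorem pi_withDensity_apply_le {ι α : Type*} [Fintype ι] [MeasurableSpace α]
    (P : Measure α) [IsProbabilityMeasure P] (L : α → ℝ≥0∞) (hL : Measurable L)
    [IsProbabilityMeasure (P.withDensity L)] {A : Set (ι → α)} (hA : MeasurableSet A) :
    Measure.pi (fun _ : ι => P.withDensity L) A ≤
      3 / 2 * Measure.pi (fun _ : ι => P) A + (∫⁻ x, L x ^ 2 ∂P) ^ Fintype.card ι / 6 := by
  rw [pi_withDensity_eq P L hL, withDensity_apply _ hA]
  calc ∫⁻ x in A, ∏ i, L (x i) ∂(Measure.pi fun _ : ι => P)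
      ≤ ∫⁻ x in A, (3 / 2 + (∏ i, L (x i) ^ 2) / 6) ∂(Measure.pi fun _ : ι => P) := by
        refine lintegral_mono fun x => ?_
        rw [Finset.prod_pow]
        exact ENNReal.le_three_halves_add_sq_div_six _
    _ = 3 / 2 * Measure.pi (fun _ : ι => P) A +
        ∫⁻ x in A, (∏ i, L (x i) ^ 2) / 6 ∂(Measure.pi fun _ : ι => P) := by
        rw [lintegral_add_left measurable_const]
        simp
    _ ≤ 3 / 2 * Measure.pi (fun _ : ι => P) A +
        ∫⁻ x, (∏ i, L (x i) ^ 2) / 6 ∂(Measure.pi fun _ : ι => P) := by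
        gcongr
        exact Measure.restrict_le_self
    _ = _ := by
        simp_rw [div_eq_mul_inv]
        rw [lintegral_mul_const _ (by fun_prop),
          lintegral_prod_pi_eq_prod (fun _ => P) (fun _ x => L x ^ 2) fun _ => by fun_prop]
        simp

/-! ### Two mixtures and their likelihood ratio -/

/-- The mixture of `Q₀` and `Q₁` with weights `(1 + a) / 2` and `(1 - a) / 2`. -/
noncomputable def tiltedMixture {α : Type*} [MeasurableSpace α] (Q₀ Q₁ : Measure α) (a : ℝ) :
    Measure α :=
  ENNReal.ofReal ((1 + a) / 2) • Q₀ + ENNReal.ofReal ((1 - a) / 2) • Q₁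

theorem isProbabilityMeasure_tiltedMixture {α : Type*} [MeasurableSpace α] (Q₀ Q₁ : Measure α)
    [IsProbabilityMeasure Q₀] [IsProbabilityMeasure Q₁] {a : ℝ} (h₀ : 0 ≤ a) (h₁ : a ≤ 1) :
    IsProbabilityMeasure (tiltedMixture Q₀ Q₁ a) := by
  constructor
  simp only [tiltedMixture, Measure.coe_add, Measure.coe_smul, Pi.add_apply, Pi.smul_apply,
    measure_univ, smul_eq_mul, mul_one]
  rw [← ENNReal.ofReal_add (by linarith) (by linarith)]
  simp only [ENNReal.ofReal_eq_one]
  ring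

open Classical in
/-- The likelihood ratio between a tilted and the balanced mixture of two measures that are
separated by `S`. -/
noncomputable def tiltRatio {α : Type*} (S : Set α) (a : ℝ) (x : α) : ℝ≥0∞ :=
  if x ∈ S then ENNReal.ofReal (1 + a) else ENNReal.ofReal (1 - a)

theorem measurable_tiltRatio {α : Type*} [MeasurableSpace α] {S : Set α} (hS : MeasurableSet S)
    (a : ℝ) : Measurable (tiltRatio S a) :=
  Measurable.ite hS measurable_const measurable_const

section Separated

variable {α : Type*} [MeasurableSpace α] {Q₀ Q₁ : Measure α} {S : Set α}

theorem tiltRatio_ae_eq_left (h₀ : Q₀ Sᶜ = 0) (a : ℝ) :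
    tiltRatio S a =ᵐ[Q₀] fun _ => ENNReal.ofReal (1 + a) := by
  have h : ∀ᵐ x ∂Q₀, x ∈ S := h₀
  filter_upwards [h] with x hx
  simp [tiltRatio, hx]

theorem tiltRatio_ae_eq_right (h₁ : Q₁ S = 0) (a : ℝ) :
    tiltRatio S a =ᵐ[Q₁] fun _ => ENNReal.ofReal (1 - a) := by
  have h : ∀ᵐ x ∂Q₁, x ∉ S := measure_eq_zero_iff_ae_notMem.mp h₁
  filter_upwards [h] with x hx
  simp [tiltRatio, hx]

/-- Only `Q₀` charges `S` and only `Q₁` charges its complement, so the ratio just rescales the two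
weights `1/2`. -/
theorem withDensity_tiltRatio (h₀ : Q₀ Sᶜ = 0) (h₁ : Q₁ S = 0) (a : ℝ) :
    (tiltedMixture Q₀ Q₁ 0).withDensity (tiltRatio S a) = tiltedMixture Q₀ Q₁ a := by
  rw [tiltedMixture, withDensity_add_measure, withDensity_smul_measure, withDensity_smul_measure,
    withDensity_congr_ae (tiltRatio_ae_eq_left h₀ a),
    withDensity_congr_ae (tiltRatio_ae_eq_right h₁ a), withDensity_const, withDensity_const,
    smul_smul, smul_smul, ← ENNReal.ofReal_mul (by norm_num), ← ENNReal.ofReal_mul (by norm_num),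
    tiltedMixture]
  congr 3 <;> ring_nf

theorem lintegral_tiltRatio_sq [IsProbabilityMeasure Q₀] [IsProbabilityMeasure Q₁]
    (h₀ : Q₀ Sᶜ = 0) (h₁ : Q₁ S = 0) {a : ℝ} (ha₀ : 0 ≤ a) (ha₁ : a ≤ 1) :
    ∫⁻ x, tiltRatio S a x ^ 2 ∂(tiltedMixture Q₀ Q₁ 0) = ENNReal.ofReal (1 + a ^ 2) := by
  have hl : (fun x => tiltRatio S a x ^ 2) =ᵐ[Q₀] fun _ => ENNReal.ofReal (1 + a) ^ 2 :=
    (tiltRatio_ae_eq_left h₀ a).fun_comp (· ^ 2)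
  have hr : (fun x => tiltRatio S a x ^ 2) =ᵐ[Q₁] fun _ => ENNReal.ofReal (1 - a) ^ 2 :=
    (tiltRatio_ae_eq_right h₁ a).fun_comp (· ^ 2)
  rw [tiltedMixture, lintegral_add_measure, lintegral_smul_measure, lintegral_smul_measure,
    lintegral_congr_ae hl, lintegral_congr_ae hr]
  simp only [lintegral_const, measure_univ, mul_one, smul_eq_mul]
  rw [← ENNReal.ofReal_pow (by linarith), ← ENNReal.ofReal_pow (by linarith),
    ← ENNReal.ofReal_mul (by norm_num), ← ENNReal.ofReal_mul (by norm_num),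
    ← ENNReal.ofReal_add (by positivity) (by positivity)]
  congr 1
  ring

end Separated

/-! ### Distances between kernel means -/

theorem kernelMean_tiltedMixture_sub {d : ℕ} (ν : Measure ℝ≥0) [IsFiniteMeasure ν]
    (Q₀ Q₁ : Measure (EuclideanSpace ℝ (Fin d))) [IsProbabilityMeasure Q₀]
    [IsProbabilityMeasure Q₁] {a : ℝ} (h₀ : 0 ≤ a) (h₁ : a ≤ 1) :
    kernelMean ν (tiltedMixture Q₀ Q₁ a) - kernelMean ν (tiltedMixture Q₀ Q₁ 0) =
      (a / 2) • (kernelMean ν Q₀ - kernelMean ν Q₁) := by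
  have h : ∀ b : ℝ, 0 ≤ b → b ≤ 1 → kernelMean ν (tiltedMixture Q₀ Q₁ b) =
      ((1 + b) / 2) • kernelMean ν Q₀ + ((1 - b) / 2) • kernelMean ν Q₁ := by
    intro b hb₀ hb₁
    rw [kernelMean, tiltedMixture, integral_add_measure
      ((integrable_radialFeature ν Q₀).smul_measure ENNReal.ofReal_ne_top)
      ((integrable_radialFeature ν Q₁).smul_measure ENNReal.ofReal_ne_top),
      integral_smul_measure, integral_smul_measure, ENNReal.toReal_ofReal (by linarith),
      ENNReal.toReal_ofReal (by linarith)]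
    rfl
  rw [h a h₀ h₁, h 0 le_rfl zero_le_one]
  module

theorem le_norm_radialFeature_sub_sq {d : ℕ} (ν : Measure ℝ≥0) [IsFiniteMeasure ν]
    {t₀ t₁ β : ℝ≥0} (hνβ : (β : ℝ≥0∞) ≤ ν (Set.Icc t₀ t₁)) {x y : EuclideanSpace ℝ (Fin d)}
    (hxy : 1 ≤ t₀ * ‖x - y‖ ^ 2) : (β : ℝ) ≤ ‖radialFeature ν x - radialFeature ν y‖ ^ 2 := by
  have h1 : ‖radialFeature ν x - radialFeature ν y‖ ^ 2 =
      ∫ t : ℝ≥0, 2 * (1 - Real.exp (-(t : ℝ) * ‖x - y‖ ^ 2)) ∂ν := by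
    rw [norm_sub_sq_real, ← real_inner_self_eq_norm_sq, ← real_inner_self_eq_norm_sq,
      integral_const_mul, integral_sub (integrable_const _)
      (integrable_radialKernel_integrand ν x y)]
    simp only [inner_radialFeature, radialFeature_apply]
    rw [radialKernel_symm ν y x]
    simp only [radialKernel, sub_self, norm_zero]
    simp
    ring
  have hint : Integrable (fun t : ℝ≥0 => 2 * (1 - Real.exp (-(t : ℝ) * ‖x - y‖ ^ 2))) ν :=
    ((integrable_const _).sub (integrable_radialKernel_integrand ν x y)).const_mul _
  have hnn : ∀ t : ℝ≥0, 0 ≤ 2 * (1 - Real.exp (-(t : ℝ) * ‖x - y‖ ^ 2)) := by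
    intro t
    have : Real.exp (-(t : ℝ) * ‖x - y‖ ^ 2) ≤ 1 := by
      rw [Real.exp_le_one_iff, neg_mul]
      have : 0 ≤ (t : ℝ) * ‖x - y‖ ^ 2 := by positivity
      linarith
    linarith
  have h2 : (β : ℝ) ≤ ν.real (Set.Icc t₀ t₁) := by
    have := ENNReal.toReal_mono (measure_ne_top ν _) hνβ
    simpa [Measure.real] using this
  rw [h1]
  calc (β : ℝ) ≤ ∫ t in Set.Icc t₀ t₁, (1 : ℝ) ∂ν := by simpa using h2
    -- On `[t₀, t₁]` the exponent is at most `-1`, and `2(1 - e⁻¹) ≥ 1`.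
    _ ≤ ∫ t in Set.Icc t₀ t₁, 2 * (1 - Real.exp (-(t : ℝ) * ‖x - y‖ ^ 2)) ∂ν := by
        refine setIntegral_mono_on (integrable_const _) hint.integrableOn measurableSet_Icc
          fun t htm => ?_
        have h3 : (t₀ : ℝ) ≤ t := by exact_mod_cast htm.1
        have h4 : 1 ≤ (t : ℝ) * ‖x - y‖ ^ 2 :=
          hxy.trans (mul_le_mul_of_nonneg_right h3 (sq_nonneg _))
        have h5 : Real.exp (-(t : ℝ) * ‖x - y‖ ^ 2) ≤ Real.exp (-1) :=
          Real.exp_le_exp.mpr (by linarith)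
        have h6 := Real.exp_neg_one_lt_half
        linarith
    _ ≤ _ := setIntegral_le_integral hint (ae_of_all _ hnn)

theorem norm_kernelMean_sub_radialFeature_le {d : ℕ} (ν : Measure ℝ≥0) [IsFiniteMeasure ν]
    (Q : Measure (EuclideanSpace ℝ (Fin d))) [IsProbabilityMeasure Q]
    {c : EuclideanSpace ℝ (Fin d)} {η : ℝ}
    (h : ∀ᵐ x ∂Q, ‖radialFeature ν x - radialFeature ν c‖ ≤ η) :
    ‖kernelMean ν Q - radialFeature ν c‖ ≤ η := by
  have h1 : kernelMean ν Q - radialFeature ν c =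
      ∫ x, (radialFeature ν x - radialFeature ν c) ∂Q := by
    rw [integral_sub (integrable_radialFeature ν Q) (integrable_const _)]
    simp [kernelMean]
  rw [h1]
  simpa using norm_integral_le_of_norm_le_const h

/-! ### Smooth bumps with separated kernel means -/

/-- The probability measure whose density is a normalized bump function. -/
noncomputable def bumpMeasure {d : ℕ} {c : EuclideanSpace ℝ (Fin d)} (f : ContDiffBump c) :
    Measure (EuclideanSpace ℝ (Fin d)) :=
  volume.withDensity fun x => ENNReal.ofReal (f.normed volume x)

instance isProbabilityMeasure_bumpMeasure {d : ℕ} {c : EuclideanSpace ℝ (Fin d)}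
    (f : ContDiffBump c) : IsProbabilityMeasure (bumpMeasure f) := by
  constructor
  rw [bumpMeasure, withDensity_apply _ MeasurableSet.univ, Measure.restrict_univ,
    ← ofReal_integral_eq_lintegral_ofReal f.integrable_normed (ae_of_all _ f.nonneg_normed),
    f.integral_normed, ENNReal.ofReal_one]

theorem bumpMeasure_eq_zero_of_disjoint {d : ℕ} {c : EuclideanSpace ℝ (Fin d)}
    (f : ContDiffBump c) {S : Set (EuclideanSpace ℝ (Fin d))} (hS : MeasurableSet S)
    (h : Disjoint S (Metric.ball c f.rOut)) : bumpMeasure f S = 0 := by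
  rw [bumpMeasure, withDensity_apply _ hS, setLIntegral_congr_fun hS (g := fun _ => 0)]
  · simp
  · intro x hx
    have hx' : x ∉ Function.support (f.normed volume) := by
      rw [f.support_normed_eq]
      exact Set.disjoint_left.mp h hx
    simp [Function.notMem_support.mp hx']

theorem tiltedMixture_bumpMeasure_mem {d : ℕ} {c₀ c₁ : EuclideanSpace ℝ (Fin d)}
    (f₀ : ContDiffBump c₀) (f₁ : ContDiffBump c₁) {a : ℝ} (h₀ : 0 ≤ a) (h₁ : a ≤ 1) :
    tiltedMixture (bumpMeasure f₀) (bumpMeasure f₁) a ∈ smoothDensityMeasures d := by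
  have hw₀ : 0 ≤ (1 + a) / 2 := by linarith
  have hw₁ : 0 ≤ (1 - a) / 2 := by linarith
  refine ⟨isProbabilityMeasure_tiltedMixture _ _ h₀ h₁,
    fun x => (1 + a) / 2 * f₀.normed volume x + (1 - a) / 2 * f₁.normed volume x,
    (contDiff_const.mul f₀.contDiff_normed).add (contDiff_const.mul f₁.contDiff_normed),
    fun x => add_nonneg (mul_nonneg hw₀ (f₀.nonneg_normed x)) (mul_nonneg hw₁ (f₁.nonneg_normed x)),
    ?_⟩
  have hm₀ : Measurable fun x => ENNReal.ofReal (f₀.normed volume x) :=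
    f₀.continuous_normed.measurable.ennreal_ofReal
  have hm₁ : Measurable fun x => ENNReal.ofReal (f₁.normed volume x) :=
    f₁.continuous_normed.measurable.ennreal_ofReal
  rw [tiltedMixture, bumpMeasure, bumpMeasure, ← withDensity_smul _ hm₀, ← withDensity_smul _ hm₁,
    ← withDensity_add_left (hm₀.const_smul _)]
  congr 1
  funext x
  simp only [Pi.add_apply, Pi.smul_apply, smul_eq_mul]
  rw [ENNReal.ofReal_add (mul_nonneg hw₀ (f₀.nonneg_normed x))
    (mul_nonneg hw₁ (f₁.nonneg_normed x)), ENNReal.ofReal_mul hw₀, ENNReal.ofReal_mul hw₁]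

/-- Two smooth probability measures with disjoint supports and well separated kernel means. -/
theorem exists_bumpMeasure_separated {d : ℕ} (hd : 1 ≤ d) (ν : Measure ℝ≥0) [IsFiniteMeasure ν]
    {t₀ t₁ β : ℝ≥0} (ht₀ : 0 < t₀) (hβ : 0 < β) (hνβ : (β : ℝ≥0∞) ≤ ν (Set.Icc t₀ t₁)) :
    ∃ (c₀ c₁ : EuclideanSpace ℝ (Fin d)) (f₀ : ContDiffBump c₀) (f₁ : ContDiffBump c₁),
      Disjoint (Metric.ball c₀ f₀.rOut) (Metric.ball c₁ f₁.rOut) ∧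
      1 / 2 * √β ≤ ‖kernelMean ν (bumpMeasure f₀) - kernelMean ν (bumpMeasure f₁)‖ := by
  have ht₀' : (0 : ℝ) < t₀ := ht₀
  have hβ' : (0 : ℝ) < √β := Real.sqrt_pos.mpr hβ
  -- The distance with `t₀ r² = 1`, at which the features of the centres are `√β` apart.
  set r : ℝ := (√t₀)⁻¹ with hr
  have hr₀ : 0 < r := inv_pos.mpr (Real.sqrt_pos.mpr ht₀')
  -- Replacing each centre by a bump costs `√β/4`, so half of the gap `√β` survives.
  have hloc : ∀ c : EuclideanSpace ℝ (Fin d), ∃ ρ > 0, ∀ x ∈ Metric.ball c ρ,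
      ‖radialFeature ν x - radialFeature ν c‖ ≤ √β / 4 := by
    intro c
    obtain ⟨ρ, hρ, h⟩ := Metric.continuous_iff.mp (continuous_radialFeature (d := d) ν) c (√β / 4)
      (by positivity)
    refine ⟨ρ, hρ, fun x hx => ?_⟩
    have := h x hx
    rw [dist_eq_norm] at this
    exact this.le
  have hmean : ∀ (c : EuclideanSpace ℝ (Fin d)) (f : ContDiffBump c),
      (∀ x ∈ Metric.ball c f.rOut, ‖radialFeature ν x - radialFeature ν c‖ ≤ √β / 4) →
      ‖kernelMean ν (bumpMeasure f) - radialFeature ν c‖ ≤ √β / 4 := by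
    intro c f h
    refine norm_kernelMean_sub_radialFeature_le ν _ ?_
    have h0 : ∀ᵐ x ∂(bumpMeasure f), x ∈ Metric.ball c f.rOut :=
      bumpMeasure_eq_zero_of_disjoint f Metric.isOpen_ball.measurableSet.compl disjoint_compl_left
    exact h0.mono h
  let c₁ : EuclideanSpace ℝ (Fin d) := EuclideanSpace.single ⟨0, hd⟩ r
  have hc₁ : ‖(0 : EuclideanSpace ℝ (Fin d)) - c₁‖ = r := by
    simp [c₁, abs_of_pos hr₀]
  obtain ⟨ρ₀, hρ₀, h₀⟩ := hloc 0
  obtain ⟨ρ₁, hρ₁, h₁⟩ := hloc c₁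
  -- The cap `r / 2` keeps the two balls disjoint.
  set ρ := min (min ρ₀ ρ₁) (r / 2) with hρdef
  have hρ : 0 < ρ := lt_min (lt_min hρ₀ hρ₁) (by positivity)
  have hle₀ : ρ ≤ ρ₀ := (min_le_left _ _).trans (min_le_left _ _)
  have hle₁ : ρ ≤ ρ₁ := (min_le_left _ _).trans (min_le_right _ _)
  have hle : ρ ≤ r / 2 := min_le_right _ _
  let f₀ : ContDiffBump (0 : EuclideanSpace ℝ (Fin d)) := ⟨ρ / 2, ρ, by positivity, by linarith⟩
  let f₁ : ContDiffBump c₁ := ⟨ρ / 2, ρ, by positivity, by linarith⟩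
  refine ⟨0, c₁, f₀, f₁, ?_, ?_⟩
  · refine Metric.ball_disjoint_ball ?_
    rw [dist_eq_norm, hc₁]
    change ρ + ρ ≤ r
    linarith
  · have hm₀ := hmean 0 f₀ fun x hx => h₀ x (Metric.ball_subset_ball hle₀ hx)
    have hm₁ := hmean c₁ f₁ fun x hx => h₁ x (Metric.ball_subset_ball hle₁ hx)
    have hsep : √β ≤ ‖radialFeature ν (0 : EuclideanSpace ℝ (Fin d)) - radialFeature ν c₁‖ := by
      refine Real.sqrt_le_iff.mpr ⟨norm_nonneg _, le_norm_radialFeature_sub_sq ν hνβ ?_⟩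
      rw [hc₁, hr, inv_pow, Real.sq_sqrt ht₀'.le, mul_inv_cancel₀ ht₀'.ne']
    have htri : ‖radialFeature ν (0 : EuclideanSpace ℝ (Fin d)) - radialFeature ν c₁‖ ≤
        ‖kernelMean ν (bumpMeasure f₀) - kernelMean ν (bumpMeasure f₁)‖ +
        ‖kernelMean ν (bumpMeasure f₀) - radialFeature ν 0‖ +
        ‖kernelMean ν (bumpMeasure f₁) - radialFeature ν c₁‖ := by
      calc _ = ‖(kernelMean ν (bumpMeasure f₀) - kernelMean ν (bumpMeasure f₁)) -
            (kernelMean ν (bumpMeasure f₀) - radialFeature ν 0) +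
            (kernelMean ν (bumpMeasure f₁) - radialFeature ν c₁)‖ := by congr 1; abel
        _ ≤ _ := (norm_add_le _ _).trans (by gcongr; exact norm_sub_le _ _)
    linarith

/-! ### Numerical bounds and the conclusion -/

/-- The factors `t₀/(t₁ e)` and `1 - 2/(2 + d)` are at most 1, and `1/50` leaves ample room for the
constants. -/
theorem separation_rate_le {d n : ℕ} (hn : 1 ≤ n) {t₀ t₁ β : ℝ≥0} (ht₀ : 0 < t₀) (ht : t₀ ≤ t₁) :
    2 * (1 / 50 * √(1 / (n : ℝ) * ((β : ℝ) * t₀ / (t₁ * Real.exp 1)) * (1 - 2 / (2 + (d : ℝ))))) ≤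
      √(1 / (2 * n)) / 2 * (1 / 2 * √β) := by
  have hn' : (0 : ℝ) < n := by exact_mod_cast hn
  have ht₀' : (0 : ℝ) < t₀ := ht₀
  have ht' : (t₀ : ℝ) ≤ t₁ := ht
  have hd' : (0 : ℝ) ≤ d := d.cast_nonneg
  have he : 1 ≤ Real.exp 1 := Real.one_le_exp zero_le_one
  have h1 : (β : ℝ) * t₀ / (t₁ * Real.exp 1) ≤ β := by
    have ht₁' : (0 : ℝ) < t₁ := ht₀'.trans_le ht'
    rw [div_le_iff₀ (by positivity)]
    gcongr
    nlinarith
  have h2 : 1 - 2 / (2 + (d : ℝ)) ≤ 1 := by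
    have : 0 ≤ 2 / (2 + (d : ℝ)) := by positivity
    linarith
  have h3 : 0 ≤ 1 - 2 / (2 + (d : ℝ)) := by
    rw [sub_nonneg, div_le_one (by positivity)]
    linarith
  have h4 : 1 / (n : ℝ) * ((β : ℝ) * t₀ / (t₁ * Real.exp 1)) * (1 - 2 / (2 + (d : ℝ))) ≤
      4 * (1 / (2 * n) * β) := by
    calc _ ≤ 1 / (n : ℝ) * β * 1 := by gcongr
      _ ≤ 2 * (1 / (n : ℝ) * β) := by
          have : 0 ≤ 1 / (n : ℝ) * β := by positivity
          linarith
      _ = _ := by field_simp; ring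
  have h5 := Real.sqrt_le_sqrt h4
  rw [show 4 * (1 / (2 * (n : ℝ)) * β) = 2 ^ 2 * (1 / (2 * (n : ℝ)) * β) by norm_num,
    Real.sqrt_mul (by norm_num : (0 : ℝ) ≤ 2 ^ 2), Real.sqrt_sq (by norm_num),
    Real.sqrt_mul (by positivity : 0 ≤ 1 / (2 * (n : ℝ)))] at h5
  have h6 : 0 ≤ √(1 / (2 * (n : ℝ))) * √β := by positivity
  linarith

/-- From `1 + x ≤ eˣ` the power is at most `√e`, and `e < (9/5)²`. -/
theorem one_add_half_inv_pow_le {n : ℕ} (hn : 1 ≤ n) :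
    (1 + 1 / (2 * (n : ℝ))) ^ n ≤ 9 / 5 := by
  have hn' : (0 : ℝ) < n := by exact_mod_cast hn
  have h1 : (1 + 1 / (2 * (n : ℝ))) ^ n ≤ Real.exp (1 / 2) := by
    calc (1 + 1 / (2 * (n : ℝ))) ^ n ≤ Real.exp (1 / (2 * n)) ^ n := by
          gcongr
          linarith [Real.add_one_le_exp (1 / (2 * (n : ℝ)))]
      _ = Real.exp (1 / 2) := by
          rw [← Real.exp_nat_mul]
          congr 1
          field_simp
  have h2 : Real.exp (1 / 2) * Real.exp (1 / 2) = Real.exp 1 := by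
    rw [← Real.exp_add]
    norm_num
  nlinarith [Real.exp_one_lt_d9, Real.exp_pos (1 / 2)]

theorem theorem8 (d n : ℕ) (hd : 1 ≤ d) (hn : 1 ≤ n) (ν : Measure ℝ≥0) [IsFiniteMeasure ν]
    (hν : ν.support ≠ {0}) (t₀ t₁ β : ℝ≥0) (ht₀ : 0 < t₀) (ht : t₀ ≤ t₁) (hβ : 0 < β)
    (hνβ : (β : ℝ≥0∞) ≤ ν (Set.Icc t₀ t₁)) :
    (1 / 5 : ℝ≥0∞) ≤
      ⨅ θ : Estimator n d ν, ⨆ P ∈ smoothDensityMeasures d,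
        Measure.pi (fun _ : Fin n => P)
          {X | 1 / 50 * √(1 / (n : ℝ) * ((β : ℝ) * t₀ / (t₁ * Real.exp 1)) *
              (1 - 2 / (2 + (d : ℝ)))) ≤ ‖θ.1 X - kernelMean ν P‖} := by
  refine le_iInf fun θ => ?_
  have hrate := separation_rate_le (d := d) (β := β) hn ht₀ ht
  set s : ℝ := 1 / 50 * √(1 / (n : ℝ) * ((β : ℝ) * t₀ / (t₁ * Real.exp 1)) *
    (1 - 2 / (2 + (d : ℝ))))
  obtain ⟨c₀, c₁, f₀, f₁, hdisj, hsep⟩ := exists_bumpMeasure_separated hd ν ht₀ hβ hνβ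
  have hn' : (1 : ℝ) ≤ n := by exact_mod_cast hn
  set a : ℝ := √(1 / (2 * n)) with ha
  have ha₀ : 0 ≤ a := Real.sqrt_nonneg _
  have ha₁ : a ≤ 1 := by
    refine Real.sqrt_le_iff.mpr ⟨zero_le_one, ?_⟩
    rw [div_le_iff₀ (by positivity)]
    linarith
  have hasq : a ^ 2 = 1 / (2 * n) := Real.sq_sqrt (by positivity)
  have hS : MeasurableSet (Metric.ball c₀ f₀.rOut) := Metric.isOpen_ball.measurableSet
  have hQ₀ := bumpMeasure_eq_zero_of_disjoint f₀ hS.compl disjoint_compl_left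
  have hQ₁ := bumpMeasure_eq_zero_of_disjoint f₁ hS hdisj
  have hmem₀ := tiltedMixture_bumpMeasure_mem f₀ f₁ le_rfl zero_le_one
  have hmem₁ := tiltedMixture_bumpMeasure_mem f₀ f₁ ha₀ ha₁
  have hprob₀ := hmem₀.1
  have hprob₁ := hmem₁.1
  have hdist : 2 * s ≤ ‖kernelMean ν (tiltedMixture (bumpMeasure f₀) (bumpMeasure f₁) a) -
      kernelMean ν (tiltedMixture (bumpMeasure f₀) (bumpMeasure f₁) 0)‖ := by
    rw [kernelMean_tiltedMixture_sub ν _ _ ha₀ ha₁, norm_smul, Real.norm_of_nonneg (by positivity)]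
    exact hrate.trans (by gcongr)
  have hdens := withDensity_tiltRatio hQ₀ hQ₁ a
  have hmom := lintegral_tiltRatio_sq hQ₀ hQ₁ ha₀ ha₁
  set P₀ := tiltedMixture (bumpMeasure f₀) (bumpMeasure f₁) 0
  set P₁ := tiltedMixture (bumpMeasure f₀) (bumpMeasure f₁) a
  set A : Set (Fin n → EuclideanSpace ℝ (Fin d)) := {X | s ≤ ‖θ.1 X - kernelMean ν P₀‖}
  set B : Set (Fin n → EuclideanSpace ℝ (Fin d)) := {X | s ≤ ‖θ.1 X - kernelMean ν P₁‖} with hB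
  have hAm : MeasurableSet A :=
    measurableSet_le measurable_const
      ((continuous_id.sub continuous_const).norm.measurable.comp θ.2)
  -- An estimate within `s` of one kernel mean is at least `s` away from the other.
  have hAB : Aᶜ ⊆ B := by
    intro X hX
    have hX' : ‖θ.1 X - kernelMean ν P₀‖ < s := not_le.mp hX
    rw [hB, Set.mem_ofPred_eq]
    have htri : ‖kernelMean ν P₁ - kernelMean ν P₀‖ ≤
        ‖θ.1 X - kernelMean ν P₁‖ + ‖θ.1 X - kernelMean ν P₀‖ := by
      rw [norm_sub_rev (θ.1 X) (kernelMean ν P₁)]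
      exact norm_sub_le_norm_sub_add_norm_sub _ _ _
    linarith
  by_contra! hlt
  have hA : Measure.pi (fun _ : Fin n => P₀) A < 1 / 5 :=
    (le_iSup₂_of_le P₀ hmem₀ le_rfl).trans_lt hlt
  have hBlt : Measure.pi (fun _ : Fin n => P₁) Aᶜ < 1 / 5 :=
    (measure_mono hAB).trans_lt ((le_iSup₂_of_le P₁ hmem₁ le_rfl).trans_lt hlt)
  have : IsProbabilityMeasure (P₀.withDensity (tiltRatio (Metric.ball c₀ f₀.rOut) a)) :=
    hdens ▸ hprob₁
  have hbound := pi_withDensity_apply_le P₀ _ (measurable_tiltRatio hS a) hAm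
  rw [hdens, hmom, hasq, Fintype.card_fin, ← ENNReal.ofReal_pow (by positivity)] at hbound
  have hpow : ENNReal.ofReal ((1 + 1 / (2 * (n : ℝ))) ^ n) ≤ ENNReal.ofReal (9 / 5) :=
    ENNReal.ofReal_le_ofReal (one_add_half_inv_pow_le hn)
  -- The right side is `3/10 + 3/10 + 1/5 = 4/5`, which is the contradiction.
  have htot : (1 : ℝ≥0∞) ≤ 3 / 2 * (1 / 5) + ENNReal.ofReal (9 / 5) / 6 + 1 / 5 := by
    calc (1 : ℝ≥0∞) = Measure.pi (fun _ : Fin n => P₁) A + Measure.pi (fun _ : Fin n => P₁) Aᶜ := by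
          rw [prob_add_prob_compl hAm]
      _ ≤ _ := by
          gcongr
          exact hbound.trans (by gcongr)
  have htot' := ENNReal.toReal_mono (by finiteness) htot
  rw [ENNReal.toReal_add (by finiteness) (by finiteness),
    ENNReal.toReal_add (by finiteness) (by finiteness)] at htot'
  simp only [ENNReal.toReal_mul, ENNReal.toReal_div, ENNReal.toReal_ofNat, ENNReal.toReal_one,
    ENNReal.toReal_ofReal (show (0 : ℝ) ≤ 9 / 5 by norm_num)] at htot'
  norm_num at htot'
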